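/- Let $n,m,n_c,\ell,\ell_u$ be positive integers. **Plant and constraints.** Consider $\dot x=f(x)+g(x)u$ with $f:\mathbb R^n\to\mathbb R^n$, $g:\mathbb R^n\to\mathbb R^{n\times m}$ locally Lipschitz. Let $h_1,\dots,h_\ell:\mathbb R^n\to\mathbb R$ and $\phi_1,\dots,\phi_{\ell_u}:\mathbb R^m\to\mathbb R$ be continuously differentiable, $S_s=\{x: h_j(x)\ge 0 \text{ for all } j\}$ (the safe set) and $U=\{u:\phi_\kappa(u)\ge 0\text{ for all }\kappa\}$ (the admissible inputs), with $\phi_\kappa'(u)\neq 0$ for all $u\in U$ and all $\kappa$. Let $Q$ and $c$ be locally Lipschitz on $\mathbb R^n$, with $Q(x)\in\mathbb R^{m\times m}$ symmetric positive definite and $c(x)\in\mathbb R^m$. For a map $\eta$ write $L_\psi\eta(x)=\eta'(x)\psi(x)$, and $L^i_\psi$ for the iterates if $\psi$ is a vector field. **Control dynamics.** The control is generated by $\dot x_c=f_c(x_c)+g_c(x_c)\hat u(x,x_c)$, $u=h_c(x_c)$, where $f_c:\mathbb R^{n_c}\to\mathbb R^{n_c}$, $g_c:\mathbb R^{n_c}\to\mathbb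 R^{n_c\times m}$, $h_c:\mathbb R^{n_c}\to\mathbb R^m$ are locally Lipschitz. Let $S_c=\{x_c:h_c(x_c)\in U\}$, $\hat x=(x,x_c)$, $\hat f(\hat x)=(f(x)+g(x)h_c(x_c),\,f_c(x_c))$ and $\hat g(\hat x)=\begin{bmatrix}0\\ g_c(x_c)\end{bmatrix}$. **Conditions.** There are positive integers $d_1,\dots,d_\ell,d_c,\zeta$ such that * (A1) for all $j$: $L_gL_f^ih_j(x)=0$ for all $x\in\mathbb R^n$ and $0\le i\le d_j-2$, and $L_gL_f^{d_j-1}h_j(x)\ne0$ for all $x\in S_s$; * (C1) for all $x_c\in\mathbb R^{n_c}$: $L_{g_c}L_{f_c}^ih_c(x_c)=0$ for $0\le i\le d_c-2$, and $L_{g_c}L_{f_c}^{d_c-1}h_c(x_c)$ is nonsingular; * (C2) for all $\kappa$: $L_{g_c}L_{f_c}^i(\phi_\kappa\circ h_c)(x_c)=0$ for all $x_c\in\mathbb R^{n_c}$ and $0\le i\le\zeta-2$, and $L_{g_c}L_{f_c}^{\zeta-1}(\phi_\kappa\circ h_c)(x_c)\neq0$ for all $x_c\in S_c$. **Composite soft-minimum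 R-CBF.** Let $\hat\ell=\ell+\ell_u$. For $1\le j\le\ell$ let $\hat h_j(\hat x)=h_j(x)$ and $\hat d_j=d_j+d_c$; for $\ell<j\le\hat\ell$ let $\hat h_j(\hat x)=\phi_{j-\ell}(h_c(x_c))$ and $\hat d_j=\zeta$. Let $\hat b_{j,0}=\hat h_j$ and $\hat b_{j,i+1}=L_{\hat f}\hat b_{j,i}+\hat\alpha_{j,i}(\hat b_{j,i})$ for $0\le i\le\hat d_j-2$, where each $\hat\alpha_{j,i}:\mathbb R\to\mathbb R$ is locally Lipschitz, strictly increasing and zero at $0$. Let $\hat C_{j,i}=\{\hat b_{j,i}\ge0\}$; let $\hat C_j=\hat C_{j,0}$ if $\hat d_j=1$ and $\hat C_j=\bigcap_{i=0}^{\hat d_j-2}\hat C_{j,i}$ if $\hat d_j>1$; let $\hat C=\bigcap_j\hat C_j$. For $\rho>0$ let $$\hat h(\hat x)=-\tfrac1\rho\log\sum_{j=1}^{\hat\ell}e^{-\rho\,\hat b_{j,\hat d_j-1}(\hat x)},\qquad \hat H=\{\hat h\ge0\},\qquad \hat S=\hat H\cap\hat C,\qquad \hat B=\{\hat x\in\partial\hat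 H: L_{\hat f}\hat h(\hat x)\le0\}.$$ **Surrogate control.** Let $u_d(\hat x)=-Q(x)^{-1}c(x)$, let $\sigma_0,\dots,\sigma_{d_c-1}>0$ be such that all roots of $s^{d_c}+\sigma_{d_c-1}s^{d_c-1}+\dots+\sigma_0$ have negative real part, and let $$\hat u_d(\hat x)=\big(L_{g_c}L_{f_c}^{d_c-1}h_c(x_c)\big)^{-1}\Big(L_{\hat f}^{d_c}u_d(\hat x)-L_{f_c}^{d_c}h_c(x_c)+\sum_{i=0}^{d_c-1}\sigma_i\big(L_{\hat f}^iu_d(\hat x)-L_{f_c}^ih_c(x_c)\big)\Big).$$ Let $\gamma>0$, let $\alpha:\mathbb R\to\mathbb R$ be locally Lipschitz and nondecreasing with $\alpha(0)=0$, and let $\hat\omega=L_{\hat f}\hat h+L_{\hat g}\hat h\,\hat u_d+\alpha(\hat h)$. The surrogate control is $$\hat u(\hat x)=\hat u_d(\hat x)+L_{\hat g}\hat h(\hat x)^{T}\hat\lambda(\hat x),\qquad \hat\lambda(\hat x)=\begin{cases}-\dfrac{\hat\omega(\hat x)}{L_{\hat g}\hat h(\hat x)L_{\hat g}\hat h(\hat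 x)^T+\gamma^{-1}\hat h(\hat x)^2},&\hat\omega(\hat x)<0,\\ 0,&\hat\omega(\hat x)\ge0.\end{cases}$$ **Smoothness convention.** All functions that are differentiated above are continuously differentiable: $L_f^ih_j$ ($i<d_j$), $L_{f_c}^ih_c$ ($i<d_c$), $L_{f_c}^i(\phi_\kappa\circ h_c)$ ($i<\zeta$), $L_{\hat f}^iu_d$ ($i<d_c$) and $\hat b_{j,i}$ ($i<\hat d_j$). **Claim.** Assume that $\hat h'$ is locally Lipschitz on $\hat S$ and that $L_{\hat g}\hat h(\hat x)\ne0$ for all $\hat x\in\hat B$. Let $\hat x_0\in\hat S$, let $0\le t_{\max}\le\infty$, and let $\hat x(t)=(x(t),x_c(t))$ be any solution of the closed loop $\dot{\hat x}=\hat f(\hat x)+\hat g(\hat x)\hat u(\hat x)$, $\hat x(0)=\hat x_0$, on $[0,t_{\max})$ (in particular the solution on its maximal interval of existence). Then for all $t\in[0,t_{\max})$: $\hat x(t)\in\hat S$, $x(t)\in S_s$, and $u(t)=h_c(x_c(t))\in U$. -/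

import Mathlib

noncomputable section

/-- Euclidean space of dimension `k`. -/
abbrev Euc (k : ℕ) : Type := EuclideanSpace ℝ (Fin k)

/-- The space of cascade states `x̂ = (x, x_c)`. -/
abbrev CascadeState (n nc : ℕ) : Type := Euc n × Euc nc

section LieDerivatives

variable {X V W : Type*} [NormedAddCommGroup X] [NormedSpace ℝ X]
  [NormedAddCommGroup V] [NormedSpace ℝ V] [NormedAddCommGroup W] [NormedSpace ℝ W]

/-- Lie derivative `L_ψ η (x) = η'(x) ψ(x)` along a vector field `ψ`.
The iterate `(lieD ψ)^[i] η` is `L_ψ^i η`. -/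
def lieD (ψ : X → X) (η : X → W) : X → W :=
  fun x => fderiv ℝ η x (ψ x)

/-- Lie derivative `L_ψ η (x) = η'(x) ψ(x)` along a matrix-valued map `ψ`, where the matrix `ψ x`
is the linear map `ψ x : V → X` and so `L_ψ η (x)` is the linear map `V → W`. -/
def lieDM (ψ : X → (V →L[ℝ] X)) (η : X → W) : X → (V →L[ℝ] W) :=
  fun x => (fderiv ℝ η x).comp (ψ x)

end LieDerivatives

/-- The transpose of a row vector, seen as a linear functional on `ℝᵐ`. -/
def rowTranspose {m : ℕ} (L : Euc m →L[ℝ] ℝ) : Euc m :=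
  (InnerProductSpace.toDual ℝ (Euc m)).symm L

/-- Log-sum-exponential soft minimum with parameter `ρ`. -/
def softmin {ι : Type*} [Fintype ι] (ρ : ℝ) (z : ι → ℝ) : ℝ :=
  -(1 / ρ) * Real.log (∑ i, Real.exp (-ρ * z i))

/-- Extended class-K functions: continuous, strictly increasing, vanishing at `0`. -/
def IsExtendedClassK (a : ℝ → ℝ) : Prop :=
  Continuous a ∧ StrictMono a ∧ a 0 = 0

/-- The time interval `[0, tmax)`, where `tmax` may be `+∞`. -/
def timeInterval (tmax : EReal) : Set ℝ :=
  {t | 0 ≤ t ∧ (t : EReal) < tmax}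

/-- `x` solves `ẋ = F(x)`, `x(0) = x₀` on `[0, tmax)` (with the right derivative at `0`). -/
def IsSolution {X : Type*} [NormedAddCommGroup X] [NormedSpace ℝ X]
    (F : X → X) (x₀ : X) (tmax : EReal) (x : ℝ → X) : Prop :=
  x 0 = x₀ ∧
    ∀ t ∈ timeInterval tmax, HasDerivWithinAt x (F (x t)) (timeInterval tmax) t

/-- The data: plant, cost, safety constraints, input constraints, control dynamics and the
user-selected parameters. No property is assumed here. -/
structure SafetyData (n m nc ℓ ℓu : ℕ) where
  /-- drift of the plant -/
  f : Euc n → Euc n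
  /-- input matrix of the plant -/
  g : Euc n → (Euc m →L[ℝ] Euc n)
  /-- safety constraint functions -/
  h : Fin ℓ → Euc n → ℝ
  /-- relative degrees of the safety constraint functions -/
  d : Fin ℓ → ℕ
  /-- quadratic part of the cost `J(x, u) = ½ uᵀ Q(x) u + c(x)ᵀ u` -/
  Q : Euc n → (Euc m →L[ℝ] Euc m)
  /-- linear part of the cost -/
  c : Euc n → Euc m
  /-- input constraint functions -/
  φ : Fin ℓu → Euc m → ℝ
  /-- drift of the control dynamics -/
  fc : Euc nc → Euc nc
  /-- input matrix of the control dynamics -/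
  gc : Euc nc → (Euc m →L[ℝ] Euc nc)
  /-- output map of the control dynamics -/
  hc : Euc nc → Euc m
  /-- relative degree of the control dynamics -/
  dc : ℕ
  /-- relative degree of the input constraint functions -/
  ζ : ℕ
  /-- the functions `α̂_{j,i}`, used for `i + 2 ≤ d̂_j` -/
  αHat : Fin ℓ ⊕ Fin ℓu → ℕ → ℝ → ℝ
  /-- soft-minimum parameter -/
  ρ : ℝ
  /-- slack weight -/
  γ : ℝ
  /-- the function `α` in the barrier constraint -/
  α : ℝ → ℝ
  /-- the gains `σ_i`, used for `i < d_c` -/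
  σ : ℕ → ℝ

namespace SafetyData

variable {n m nc ℓ ℓu : ℕ} (S : SafetyData n m nc ℓ ℓu)

/-- The safe set `S_s`. -/
def safeSet : Set (Euc n) :=
  {x | ∀ j, 0 ≤ S.h j x}

/-- The admissible input set `U`. -/
def inputSet : Set (Euc m) :=
  {u | ∀ κ, 0 ≤ S.φ κ u}

/-- The set `S_c` of controller states whose control is admissible. -/
def controllerSet : Set (Euc nc) :=
  {xc | S.hc xc ∈ S.inputSet}

/-- Condition A1: `h_j` has relative degree `d_j` on the safe set. -/
def CondA1 : Prop :=
  ∀ j, 0 < S.d j ∧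
    (∀ x, ∀ i, i + 2 ≤ S.d j → lieDM S.g ((lieD S.f)^[i] (S.h j)) x = 0) ∧
    (∀ x ∈ S.safeSet, lieDM S.g ((lieD S.f)^[S.d j - 1] (S.h j)) x ≠ 0)

/-- Condition C1: the control dynamics have relative degree `d_c` with nonsingular decoupling
matrix everywhere. -/
def CondC1 : Prop :=
  0 < S.dc ∧
    (∀ xc, ∀ i, i + 2 ≤ S.dc → lieDM S.gc ((lieD S.fc)^[i] S.hc) xc = 0) ∧
    (∀ xc, IsUnit (lieDM S.gc ((lieD S.fc)^[S.dc - 1] S.hc) xc))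

/-- Condition C2: every `φ_κ ∘ h_c` has relative degree `ζ` on `S_c`. -/
def CondC2 : Prop :=
  0 < S.ζ ∧
    (∀ κ xc, ∀ i, i + 2 ≤ S.ζ →
      lieDM S.gc ((lieD S.fc)^[i] (S.φ κ ∘ S.hc)) xc = 0) ∧
    (∀ κ, ∀ xc ∈ S.controllerSet,
      lieDM S.gc ((lieD S.fc)^[S.ζ - 1] (S.φ κ ∘ S.hc)) xc ≠ 0)

/-- Drift `f̂` of the cascade. -/
def fHat : CascadeState n nc → CascadeState n nc :=
  fun z => (S.f z.1 + S.g z.1 (S.hc z.2), S.fc z.2)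

/-- Input matrix `ĝ` of the cascade. -/
def gHat : CascadeState n nc → (Euc m →L[ℝ] CascadeState n nc) :=
  fun z => (0 : Euc m →L[ℝ] Euc n).prod (S.gc z.2)

/-- The constraint functions `ĥ_j` of the cascade; the index set `{1, …, ℓ + ℓ_u}` is
`Fin ℓ ⊕ Fin ℓu`. -/
def hHatJ : Fin ℓ ⊕ Fin ℓu → CascadeState n nc → ℝ
  | Sum.inl j => fun z => S.h j z.1
  | Sum.inr κ => fun z => S.φ κ (S.hc z.2)

/-- The relative degrees `d̂_j`. -/
def dHat : Fin ℓ ⊕ Fin ℓu → ℕ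
  | Sum.inl j => S.d j + S.dc
  | Sum.inr _ => S.ζ

/-- The functions `b̂_{j,i}`. -/
def bHat (j : Fin ℓ ⊕ Fin ℓu) : ℕ → CascadeState n nc → ℝ
  | 0 => S.hHatJ j
  | i + 1 => fun z => lieD S.fHat (bHat j i) z + S.αHat j i (bHat j i z)

/-- The sets `Ĉ_{j,i}`. -/
def CHatJI (j : Fin ℓ ⊕ Fin ℓu) (i : ℕ) : Set (CascadeState n nc) :=
  {z | 0 ≤ S.bHat j i z}

/-- The sets `Ĉ_j`. -/
def CHatJ (j : Fin ℓ ⊕ Fin ℓu) : Set (CascadeState n nc) :=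
  if S.dHat j = 1 then S.CHatJI j 0 else ⋂ i ∈ Finset.range (S.dHat j - 1), S.CHatJI j i

/-- The set `Ĉ`. -/
def CHat : Set (CascadeState n nc) :=
  ⋂ j, S.CHatJ j

/-- The composite soft-minimum function `ĥ`. -/
def hHat : CascadeState n nc → ℝ :=
  fun z => softmin S.ρ (fun j => S.bHat j (S.dHat j - 1) z)

/-- The zero-superlevel set `Ĥ` of `ĥ`. -/
def HHat : Set (CascadeState n nc) :=
  {z | 0 ≤ S.hHat z}

/-- The set `Ŝ = Ĥ ∩ Ĉ`. -/
def SHat : Set (CascadeState n nc) :=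
  S.HHat ∩ S.CHat

/-- The set `B̂`. -/
def BHat : Set (CascadeState n nc) :=
  {z | z ∈ frontier S.HHat ∧ lieD S.fHat S.hHat z ≤ 0}

/-- The desired control `u_d(x̂) = -Q(x)⁻¹ c(x)`. -/
def uD : CascadeState n nc → Euc m :=
  fun z => -((S.Q z.1).inverse (S.c z.1))

/-- The desired surrogate control. -/
def uHatD : CascadeState n nc → Euc m :=
  fun z => (lieDM S.gc ((lieD S.fc)^[S.dc - 1] S.hc) z.2).inverse
    ((lieD S.fHat)^[S.dc] S.uD z - (lieD S.fc)^[S.dc] S.hc z.2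
      + ∑ i ∈ Finset.range S.dc,
          S.σ i • ((lieD S.fHat)^[i] S.uD z - (lieD S.fc)^[i] S.hc z.2))

/-- `L_f̂ ĥ + L_ĝ ĥ û_d + α(ĥ)`; the set `Ω̂` is where it is negative. -/
def ωHat : CascadeState n nc → ℝ :=
  fun z => lieD S.fHat S.hHat z + lieDM S.gHat S.hHat z (S.uHatD z) + S.α (S.hHat z)

/-- The set `Ω̂`. -/
def ΩHat : Set (CascadeState n nc) :=
  {z | S.ωHat z < 0}

open scoped Classical in
/-- The multiplier `λ̂`. -/
def lamHat : CascadeState n nc → ℝ :=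
  fun z =>
    if z ∈ S.ΩHat then
      -(S.ωHat z / (lieDM S.gHat S.hHat z (rowTranspose (lieDM S.gHat S.hHat z))
        + S.γ⁻¹ * S.hHat z ^ 2))
    else 0

/-- The closed-form surrogate control `û = û_d + (L_ĝ ĥ)ᵀ λ̂`. -/
def uHat : CascadeState n nc → Euc m :=
  fun z => S.uHatD z + S.lamHat z • rowTranspose (lieDM S.gHat S.hHat z)

/-- The closed-loop vector field `f̂ + ĝ û`. -/
def closedLoop : CascadeState n nc → CascadeState n nc :=
  fun z => S.fHat z + S.gHat z (S.uHat z)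

/-- The standing assumptions on the data. -/
structure Standing : Prop where
  f_lip : LocallyLipschitz S.f
  g_lip : LocallyLipschitz S.g
  Q_lip : LocallyLipschitz S.Q
  c_lip : LocallyLipschitz S.c
  fc_lip : LocallyLipschitz S.fc
  gc_lip : LocallyLipschitz S.gc
  hc_lip : LocallyLipschitz S.hc
  h_C1 : ∀ j, ContDiff ℝ 1 (S.h j)
  φ_C1 : ∀ κ, ContDiff ℝ 1 (S.φ κ)
  φ_deriv_ne_zero : ∀ u ∈ S.inputSet, ∀ κ, fderiv ℝ (S.φ κ) u ≠ 0
  Q_symm : ∀ x u v, inner ℝ (S.Q x u) v = inner ℝ u (S.Q x v)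
  Q_pos : ∀ x u, u ≠ 0 → 0 < inner ℝ (S.Q x u) u
  αHat_classK : ∀ j i, i + 2 ≤ S.dHat j → IsExtendedClassK (S.αHat j i)
  αHat_lip : ∀ j i, i + 2 ≤ S.dHat j → LocallyLipschitz (S.αHat j i)
  ρ_pos : 0 < S.ρ
  γ_pos : 0 < S.γ
  α_lip : LocallyLipschitz S.α
  α_mono : Monotone S.α
  α_zero : S.α 0 = 0
  σ_pos : ∀ i < S.dc, 0 < S.σ i
  σ_hurwitz : ∀ s : ℂ,
    s ^ S.dc + ∑ i ∈ Finset.range S.dc, (S.σ i : ℂ) * s ^ i = 0 → s.re < 0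

/-- The smoothness convention: every function that is differentiated in a condition or in the
construction of the control is continuously differentiable. -/
structure Smooth : Prop where
  lie_h : ∀ j, ∀ i < S.d j, ContDiff ℝ 1 ((lieD S.f)^[i] (S.h j))
  lie_hc : ∀ i < S.dc, ContDiff ℝ 1 ((lieD S.fc)^[i] S.hc)
  lie_φ : ∀ κ, ∀ i < S.ζ, ContDiff ℝ 1 ((lieD S.fc)^[i] (S.φ κ ∘ S.hc))
  lie_uD : ∀ i < S.dc, ContDiff ℝ 1 ((lieD S.fHat)^[i] S.uD)
  bHat_C1 : ∀ j, ∀ i < S.dHat j, ContDiff ℝ 1 (S.bHat j i)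

end SafetyData

end

/-! Two facts give invariance. First, `hHat` cannot become negative along the closed loop. At a zero
of `hHat` on the frontier of `HHat`, if `L_ĝ ĥ = 0`, then the point lies outside `BHat`, the drift
strictly increases `hHat`, and the multiplier vanishes nearby. Otherwise `L_ĝ ĥ` is bounded away
from zero, and the slack term `γ⁻¹ ĥ²` costs at most a multiple of `|ĥ|`. Either way `ĥ' ≥ K ĥ`
where `ĥ < 0`, and a Grönwall argument started at the last zero excludes negative values
(`exists_mul_le_fderiv_hHat`, `nonneg_along_solution`).

Second, the surrogate control does not enter the derivative of `b̂_{j,i}` for `i ≤ d̂_j - 2`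
(`lieDM_gHat_bHat_eq_zero`). These functions are only C¹, so mixed Lie derivatives cannot be
expanded. Instead, the controller state is moved along an integral curve of `g_c v`, and the drift
trajectories from the old and new points are compared. The relative degree conditions make their
constraint values agree to order `t ^ (d̂_j - 1)`, which forces equal values of `b̂_{j,i}`.

Since the soft minimum lies below every `b̂_{j,d̂_j-1}`, nonnegativity then descends in `i` through
`b̂_{j,i}' = b̂_{j,i+1} - α̂_{j,i}(b̂_{j,i})`, down to the constraints themselves at `i = 0`. -/

noncomputable section

open Filter Topology Asymptotics Set

/-! ### Orders of vanishing at `0`, gained by integration -/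

section Asymptotics

variable {F : Type*} [NormedAddCommGroup F]

theorem eq_zero_of_isBigO_pow_succ {e : ℝ → F} {k : ℕ}
    (h : e =O[𝓝 0] fun t : ℝ => t ^ (k + 1)) : e 0 = 0 := by
  obtain ⟨C, hC⟩ := h.bound
  simpa using hC.self_of_nhds

variable [NormedSpace ℝ F]

/-- A bound `C |t|ᵏ` of the derivative near `0` integrates to a bound `C |t|ᵏ⁺¹`. -/
theorem eventually_norm_le_of_hasDerivAt {e e' : ℝ → F} {k : ℕ} {C : ℝ}
    (hd : ∀ᶠ t in 𝓝 (0 : ℝ), HasDerivAt e (e' t) t) (h0 : e 0 = 0)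
    (hb : ∀ᶠ t in 𝓝 (0 : ℝ), ‖e' t‖ ≤ C * ‖t ^ k‖) :
    ∀ᶠ t in 𝓝 (0 : ℝ), ‖e t‖ ≤ C * ‖t ^ (k + 1)‖ := by
  obtain ⟨ε, hε, hball⟩ := Metric.eventually_nhds_iff_ball.1 (hd.and hb)
  filter_upwards [Metric.ball_mem_nhds (0 : ℝ) hε] with t ht
  have hsub : ∀ s ∈ uIcc 0 t, s ∈ Metric.ball (0 : ℝ) ε ∧ |s| ≤ |t| := by
    intro s hs
    have hst : |s| ≤ |t| := by
      rcases le_total 0 t with h | h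
      · rw [uIcc_of_le h] at hs
        rw [abs_of_nonneg hs.1, abs_of_nonneg h]; exact hs.2
      · rw [uIcc_of_ge h] at hs
        rw [abs_of_nonpos hs.2, abs_of_nonpos h]; linarith [hs.1]
    refine ⟨?_, hst⟩
    rw [mem_ball_zero_iff, Real.norm_eq_abs] at ht ⊢
    exact hst.trans_lt ht
  have hC : 0 ≤ C * ‖t ^ k‖ := (norm_nonneg _).trans (hball t ht).2
  have key := (convex_uIcc 0 t).norm_image_sub_le_of_norm_hasDerivWithin_le
    (f := e) (f' := e') (C := C * ‖t ^ k‖) (x := 0) (y := t)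
    (fun s hs => ((hball s (hsub s hs).1).1).hasDerivWithinAt)
    (fun s hs => by
      -- `C` may be negative; the bound at `t` then forces `t ^ k = 0`, and so `s ^ k = 0`.
      rcases lt_or_ge C 0 with hC0 | hC0
      · have h1 : ‖t ^ k‖ = 0 :=
          le_antisymm (nonpos_of_mul_nonneg_right hC hC0) (norm_nonneg _)
        have h2 : ‖s ^ k‖ ≤ ‖t ^ k‖ := by
          rw [norm_pow, norm_pow]
          exact pow_le_pow_left₀ (norm_nonneg _) (hsub s hs).2 k
        have h3 : ‖s ^ k‖ = 0 := le_antisymm (h2.trans h1.le) (norm_nonneg _)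
        have := (hball s (hsub s hs).1).2
        rw [h3] at this
        rwa [h1]
      · refine ((hball s (hsub s hs).1).2).trans (mul_le_mul_of_nonneg_left ?_ hC0)
        rw [norm_pow, norm_pow]
        exact pow_le_pow_left₀ (norm_nonneg _) (hsub s hs).2 k)
    left_mem_uIcc right_mem_uIcc
  rw [h0, sub_zero, sub_zero] at key
  rwa [pow_succ, norm_mul, ← mul_assoc]

theorem isBigO_pow_succ_of_hasDerivAt {e e' : ℝ → F} {k : ℕ}
    (hd : ∀ᶠ t in 𝓝 (0 : ℝ), HasDerivAt e (e' t) t) (h0 : e 0 = 0)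
    (hb : e' =O[𝓝 0] fun t => t ^ k) : e =O[𝓝 0] fun t => t ^ (k + 1) := by
  obtain ⟨C, hC⟩ := hb.bound
  exact IsBigO.of_bound C (eventually_norm_le_of_hasDerivAt hd h0 hC)

theorem isLittleO_pow_succ_of_hasDerivAt {e e' : ℝ → F} {k : ℕ}
    (hd : ∀ᶠ t in 𝓝 (0 : ℝ), HasDerivAt e (e' t) t) (h0 : e 0 = 0)
    (hb : e' =o[𝓝 0] fun t => t ^ k) : e =o[𝓝 0] fun t => t ^ (k + 1) :=
  IsLittleO.of_bound fun _ hC => eventually_norm_le_of_hasDerivAt hd h0 (hb.bound hC)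

/-- If `p₀, …, p_N` are successive derivatives, `p₀, …, p_{N-1}` vanish at `0` and
`p_N = O(tᴹ)`, then `p₀ = O(tᴹ⁺ᴺ)`. -/
theorem isBigO_pow_of_successive_derivatives {M N : ℕ} (p : ℕ → ℝ → F)
    (hd : ∀ i < N, ∀ᶠ t in 𝓝 (0 : ℝ), HasDerivAt (p i) (p (i + 1) t) t)
    (h0 : ∀ i < N, p i 0 = 0) (hN : p N =O[𝓝 0] fun t => t ^ M) :
    p 0 =O[𝓝 0] fun t => t ^ (M + N) := by
  induction N generalizing M with
  | zero => exact hN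
  | succ N ih =>
    have := ih (M := M + 1) (fun i hi => hd i (by omega)) (fun i hi => h0 i (by omega))
      (isBigO_pow_succ_of_hasDerivAt (hd N (by omega)) (h0 N (by omega)) hN)
    rwa [add_assoc, add_comm 1 N] at this

/-- If `e_{i+1}` is the derivative of `e_i` up to `O(e_i)` for `i < N` and `e₀ = o(tᴺ)`, then
all the continuous functions `e₀, …, e_N` vanish at `0`. -/
theorem eq_zero_of_perturbed_derivatives {N : ℕ} (e δ : ℕ → ℝ → ℝ)
    (hc : ∀ i ≤ N, ContinuousAt (e i) 0)
    (hd : ∀ i < N, ∀ᶠ t in 𝓝 (0 : ℝ), HasDerivAt (e i) (δ i t) t)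
    (hδ : ∀ i < N, e i 0 = 0 → (fun t => e (i + 1) t - δ i t) =O[𝓝 0] e i)
    (h0 : e 0 =o[𝓝 0] fun t => t ^ N) : ∀ i ≤ N, e i 0 = 0 := by
  -- Induction over the antidiagonals `j + l = i`: all estimates on one antidiagonal are needed to
  -- reach the next.
  have main : ∀ i ≤ N, ∀ j l, j + l = i → e j =o[𝓝 0] fun t : ℝ => t ^ l := by
    intro i
    induction i with
    | zero =>
      intro _ j l hjl
      obtain ⟨rfl, rfl⟩ : j = 0 ∧ l = 0 := by omega
      refine h0.trans_isBigO ?_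
      have : ContinuousAt (fun t : ℝ => t ^ N) 0 := by fun_prop
      simpa using this.tendsto.isBigO_one ℝ
    | succ i ih =>
      intro hi
      have ih := ih (by omega)
      have hz : ∀ j ≤ i, e j 0 = 0 := by
        intro j hj
        obtain ⟨l, rfl⟩ := Nat.exists_eq_add_of_le hj
        have hl := ih j l rfl
        rcases l with _ | l
        · have h1 : Tendsto (e j) (𝓝 0) (𝓝 0) := by
            simpa using (isLittleO_one_iff ℝ).1 (by simpa using hl)
          exact tendsto_nhds_unique (hc j (by omega)).tendsto h1
        · exact eq_zero_of_isBigO_pow_succ hl.isBigO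
      set c := e (i + 1) 0 with hcdef
      -- On the next antidiagonal every `e j` has leading term `c tˡ / l!`. This propagates from `j
      -- = i + 1` down to `j = 0` by integration, the perturbation `O(e j)` being negligible by the
      -- previous antidiagonal.
      have hT : ∀ l j, j + l = i + 1 →
          (fun t => e j t - c / (l.factorial : ℝ) * t ^ l) =o[𝓝 0] fun t : ℝ => t ^ l := by
        intro l
        induction l with
        | zero =>
          intro j hj
          obtain rfl : j = i + 1 := by omega
          have h1 : Tendsto (fun t => e (i + 1) t - c) (𝓝 0) (𝓝 0) := by
            have := (hc (i + 1) hi).tendsto.sub_const c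
            rwa [← hcdef, sub_self] at this
          simpa using (isLittleO_one_iff ℝ).2 h1
        | succ l ihl =>
          intro j hj
          have h1 := ihl (j + 1) (by omega)
          have h2 : (fun t => e (j + 1) t - δ j t) =o[𝓝 0] fun t : ℝ => t ^ l :=
            (hδ j (by omega) (hz j (by omega))).trans_isLittleO (ih j l (by omega))
          have h3 : (fun t => δ j t - c / (l.factorial : ℝ) * t ^ l)
              =o[𝓝 0] fun t : ℝ => t ^ l := by
            refine (h1.sub h2).congr_left fun t => by ring
          refine isLittleO_pow_succ_of_hasDerivAt ?_ ?_ h3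
          · filter_upwards [hd j (by omega)] with t ht
            have h4 := ((hasDerivAt_pow (l + 1) t).const_mul (c / ((l + 1).factorial : ℝ)))
            refine (ht.sub h4).congr_deriv ?_
            have : (l.factorial : ℝ) ≠ 0 := by exact_mod_cast l.factorial_ne_zero
            have : ((l : ℝ) + 1) ≠ 0 := by positivity
            rw [Nat.factorial_succ]
            push_cast
            field_simp
          · simp [hz j (by omega)]
      -- At `j = 0` the leading term `c tⁱ⁺¹ / (i + 1)!` must be `o(tⁱ⁺¹)`, because `e 0 = o(tᴺ)`
      -- and `i + 1 ≤ N`.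
      have hc0 : c = 0 := by
        have h1 := hT (i + 1) 0 (by omega)
        have h2 : e 0 =o[𝓝 0] fun t : ℝ => t ^ (i + 1) := by
          refine h0.trans_isBigO ?_
          obtain ⟨q, rfl⟩ := Nat.exists_eq_add_of_le hi
          have hq : ContinuousAt (fun t : ℝ => t ^ q) 0 := by fun_prop
          have := (isBigO_refl (fun t : ℝ => t ^ (i + 1)) (𝓝 0)).mul (hq.tendsto.isBigO_one ℝ)
          simpa [pow_add] using this
        have h3 : (fun t : ℝ => c / ((i + 1).factorial : ℝ) * t ^ (i + 1))
            =o[𝓝 0] fun t : ℝ => t ^ (i + 1) :=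
          (h2.sub h1).congr_left fun t => by ring
        by_contra hne
        have hne' : c / ((i + 1).factorial : ℝ) ≠ 0 :=
          div_ne_zero hne (by exact_mod_cast (i + 1).factorial_ne_zero)
        have h4 := (isLittleO_const_mul_left_iff hne').1 h3
        have h5 : (fun t : ℝ => t ^ (i + 1)) =o[𝓝[≠] 0] fun t : ℝ => t ^ (i + 1) :=
          h4.mono nhdsWithin_le_nhds
        refine isLittleO_irrefl (Eventually.frequently ?_) h5
        filter_upwards [self_mem_nhdsWithin] with t ht
        exact pow_ne_zero _ ht
      intro j l hjl
      simpa [hc0] using hT l j hjl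
  intro i hi
  have h1 : Tendsto (e i) (𝓝 0) (𝓝 0) := by
    simpa using (isLittleO_one_iff ℝ).1 (by simpa using main i hi i 0 rfl)
  exact tendsto_nhds_unique (hc i hi).tendsto h1

end Asymptotics

/-! ### Locally Lipschitz maps and local flows -/

section LocallyLipschitz

variable {E F G : Type*} [NormedAddCommGroup E] [NormedAddCommGroup F] [NormedAddCommGroup G]

theorem LocallyLipschitz.comp_fst {φ : E → G} (hφ : LocallyLipschitz φ) :
    LocallyLipschitz fun p : E × F => φ p.1 :=
  hφ.comp LipschitzWith.prod_fst.locallyLipschitz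

theorem LocallyLipschitz.comp_snd {φ : F → G} (hφ : LocallyLipschitz φ) :
    LocallyLipschitz fun p : E × F => φ p.2 :=
  hφ.comp LipschitzWith.prod_snd.locallyLipschitz

theorem LocallyLipschitz.isBigO_comp_sub {ι : Type*} {l : Filter ι} {φ : E → F}
    (hφ : LocallyLipschitz φ) {a b : ι → E} {x : E} (ha : Tendsto a l (𝓝 x))
    (hb : Tendsto b l (𝓝 x)) :
    (fun t => φ (a t) - φ (b t)) =O[l] fun t => a t - b t := by
  obtain ⟨K, s, hs, hK⟩ := hφ x
  refine IsBigO.of_bound K ?_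
  filter_upwards [ha hs, hb hs] with t h1 h2
  exact hK.norm_sub_le h1 h2

variable [NormedSpace ℝ F] [NormedSpace ℝ G]

theorem LocallyLipschitz.clm_apply {A : E → F →L[ℝ] G} {u : E → F} (hA : LocallyLipschitz A)
    (hu : LocallyLipschitz u) : LocallyLipschitz fun x => A x (u x) := by
  have h : ContDiff ℝ 1 fun p : (F →L[ℝ] G) × F => p.1 p.2 := isBoundedBilinearMap_apply.contDiff
  exact h.locallyLipschitz.comp (hA.prodMk hu)

theorem LocallyLipschitz.add_fun {u v : E → F} (hu : LocallyLipschitz u)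
    (hv : LocallyLipschitz v) : LocallyLipschitz fun x => u x + v x := by
  have h : ContDiff ℝ 1 fun p : F × F => p.1 + p.2 := contDiff_fst.add contDiff_snd
  exact h.locallyLipschitz.comp (hu.prodMk hv)

/-- Local existence for an autonomous differential equation with locally Lipschitz right side. -/
theorem LocallyLipschitz.exists_hasDerivAt [NormedSpace ℝ E] [CompleteSpace E] {V : E → E}
    (hV : LocallyLipschitz V) (x₀ : E) :
    ∃ γ : ℝ → E, γ 0 = x₀ ∧ ∃ ε > 0, ∀ t ∈ Ioo (-ε) ε, HasDerivAt γ (V (γ t)) t := by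
  obtain ⟨K, s, hs, hl⟩ := hV x₀
  have hV1 : ∀ᶠ x in 𝓝 x₀, ‖V x‖ < ‖V x₀‖ + 1 :=
    hV.continuous.norm.continuousAt.eventually_lt continuousAt_const (by simp)
  obtain ⟨a, ha, has⟩ := Metric.nhds_basis_closedBall.mem_iff.1 (inter_mem hs hV1)
  set L : ℝ := ‖V x₀‖ + 1 with hL
  have hL0 : 0 < L := by positivity
  -- At speed at most `L`, a curve stays in the ball of radius `a` for time `a / L`.
  set ε := a / L with hε
  have hε0 : 0 < ε := by positivity
  have hPL : IsPicardLindelof (fun _ => V) (tmin := -ε) (tmax := ε)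
      ⟨0, by constructor <;> linarith⟩ x₀ ⟨a, ha.le⟩ 0 ⟨L, hL0.le⟩ K := by
    refine IsPicardLindelof.of_time_independent (fun x hx => (has hx).2.le)
      (hl.mono fun x hx => (has hx).1) ?_
    simp [hε]
    field_simp
    rfl
  obtain ⟨γ, h0, hγ⟩ := hPL.exists_eq_forall_mem_Icc_hasDerivWithinAt₀
  refine ⟨γ, h0, ε, hε0, fun t ht => (hγ t (Ioo_subset_Icc_self ht)).hasDerivAt ?_⟩
  exact Icc_mem_nhds ht.1 ht.2

end LocallyLipschitz

/-! ### Comparison of trajectories -/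

section LieTrajectories

variable {X W : Type*} [NormedAddCommGroup X] [NormedSpace ℝ X]
  [NormedAddCommGroup W] [NormedSpace ℝ W]

theorem hasDerivAt_comp_trajectory {η : X → W} (hη : ContDiff ℝ 1 η) {a : ℝ → X} {v : X} {t : ℝ}
    (ha : HasDerivAt a v t) : HasDerivAt (fun s => η (a s)) (fderiv ℝ η (a t) v) t :=
  ((hη.differentiable one_ne_zero (a t)).hasFDerivAt).comp_hasDerivAt t ha

/-- Two trajectories of `ψ` whose initial points have the same iterated Lie derivatives of `η` up
to order `D - 2` have outputs that differ by `O(tᴰ⁻¹)`. -/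
theorem isBigO_output_sub {ψ : X → X} {η : X → W} {D : ℕ}
    (hη : ∀ i < D, ContDiff ℝ 1 ((lieD ψ)^[i] η)) (hD : 0 < D) {a b : ℝ → X}
    (ha : ∀ᶠ t in 𝓝 (0 : ℝ), HasDerivAt a (ψ (a t)) t)
    (hb : ∀ᶠ t in 𝓝 (0 : ℝ), HasDerivAt b (ψ (b t)) t)
    (h0 : ∀ i, i + 2 ≤ D → (lieD ψ)^[i] η (a 0) = (lieD ψ)^[i] η (b 0)) :
    (fun t => η (a t) - η (b t)) =O[𝓝 0] fun t : ℝ => t ^ (D - 1) := by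
  have hca : ContinuousAt a 0 := ha.self_of_nhds.continuousAt
  have hcb : ContinuousAt b 0 := hb.self_of_nhds.continuousAt
  -- The difference of the Lie derivatives of order `D - 1` is merely bounded, by continuity; each
  -- of the `D - 1` integrations gains one power of `t`.
  have := isBigO_pow_of_successive_derivatives (M := 0) (N := D - 1)
    (fun i t => (lieD ψ)^[i] η (a t) - (lieD ψ)^[i] η (b t))
    (fun i hi => by
      filter_upwards [ha, hb] with t hat hbt
      have := (hasDerivAt_comp_trajectory (hη i (by omega)) hat).sub
        (hasDerivAt_comp_trajectory (hη i (by omega)) hbt)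
      simp only [Function.iterate_succ_apply']
      exact this)
    (fun i hi => sub_eq_zero.2 (h0 i (by omega)))
    (by
      have hc := (hη (D - 1) (by omega)).continuous
      have : ContinuousAt (fun t => (lieD ψ)^[D - 1] η (a t) - (lieD ψ)^[D - 1] η (b t)) 0 :=
        (hc.continuousAt.comp hca).sub (hc.continuousAt.comp hcb)
      simpa using this.tendsto.isBigO_one ℝ)
  simpa using this

/-- A function with vanishing derivative along a curve is constant on the curve. -/
theorem eq_of_fderiv_curve_eq_zero {η : X → W} (hη : ContDiff ℝ 1 η) {a v : ℝ → X} {ε : ℝ}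
    (ha : ∀ t ∈ Ioo (-ε) ε, HasDerivAt a (v t) t)
    (h0 : ∀ t ∈ Ioo (-ε) ε, fderiv ℝ η (a t) (v t) = 0) {t : ℝ} (ht : t ∈ Ioo (-ε) ε) :
    η (a t) = η (a 0) := by
  have hd : ∀ s ∈ Ioo (-ε) ε, HasDerivAt (fun s => η (a s)) 0 s := fun s hs => by
    have := hasDerivAt_comp_trajectory hη (ha s hs)
    rwa [h0 s hs] at this
  refine isOpen_Ioo.is_const_of_deriv_eq_zero isPreconnected_Ioo
    (fun s hs => (hd s hs).differentiableAt.differentiableWithinAt) (fun s hs => (hd s hs).deriv)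
    ht ?_
  constructor <;> linarith [ht.1, ht.2]

end LieTrajectories

/-- Solutions of `ẋ = f(x) + g(x)u` with the same initial value and inputs that differ by `O(tᴹ)`
differ by `O(tᴹ⁺¹)`. -/
theorem isBigO_state_sub {X V : Type*} [NormedAddCommGroup X] [NormedSpace ℝ X]
    [NormedAddCommGroup V] [NormedSpace ℝ V] {f : X → X} {g : X → V →L[ℝ] X}
    (hf : LocallyLipschitz f) (hg : LocallyLipschitz g) {a b : ℝ → X} {u v : ℝ → V} {M : ℕ}
    (ha : ∀ᶠ t in 𝓝 (0 : ℝ), HasDerivAt a (f (a t) + g (a t) (u t)) t)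
    (hb : ∀ᶠ t in 𝓝 (0 : ℝ), HasDerivAt b (f (b t) + g (b t) (v t)) t)
    (h0 : a 0 = b 0) (hu : ContinuousAt u 0) (hv : ContinuousAt v 0) (huv0 : u 0 = v 0 ∨ M = 0)
    (huv : (fun t => u t - v t) =O[𝓝 0] fun t : ℝ => t ^ M) :
    (fun t => a t - b t) =O[𝓝 0] fun t : ℝ => t ^ (M + 1) := by
  have hca : ContinuousAt a 0 := ha.self_of_nhds.continuousAt
  have hcb : ContinuousAt b 0 := hb.self_of_nhds.continuousAt
  have hΦ : LocallyLipschitz fun p : X × V => f p.1 + g p.1 p.2 :=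
    hf.comp_fst.add_fun (hg.comp_fst.clm_apply LipschitzWith.prod_snd.locallyLipschitz)
  have hd : ∀ᶠ t in 𝓝 (0 : ℝ), HasDerivAt (fun t => a t - b t)
      ((f (a t) + g (a t) (u t)) - (f (b t) + g (b t) (v t))) t := by
    filter_upwards [ha, hb] with t h1 h2 using h1.sub h2
  have hcont := hΦ.continuous
  rcases huv0 with huv0 | rfl
  · have hΦO := hΦ.isBigO_comp_sub (a := fun t => (a t, u t)) (b := fun t => (b t, v t))
      (l := 𝓝 (0 : ℝ)) (x := (a 0, u 0)) (hca.prodMk hu) (by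
        rw [h0, huv0]; exact hcb.prodMk hv)
    -- Bootstrap: a state difference `O(tᵏ)` with `k ≤ M` makes the velocity difference `O(tᵏ)`,
    -- hence the state difference `O(tᵏ⁺¹)`.
    have step : ∀ k ≤ M + 1, (fun t => a t - b t) =O[𝓝 0] fun t : ℝ => t ^ k := by
      intro k
      induction k with
      | zero => intro _; simpa using (hca.sub hcb).tendsto.isBigO_one ℝ
      | succ k ih =>
        intro hk
        refine isBigO_pow_succ_of_hasDerivAt hd (by simp [h0]) (hΦO.trans ?_)
        refine (ih (by omega)).prod_left (huv.trans ?_)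
        obtain ⟨q, rfl⟩ := Nat.exists_eq_add_of_le (Nat.le_of_succ_le_succ hk)
        have hq : ContinuousAt (fun t : ℝ => t ^ q) 0 := by fun_prop
        simpa [pow_add] using
          (isBigO_refl (fun t : ℝ => t ^ k) (𝓝 0)).mul (hq.tendsto.isBigO_one ℝ)
    exact step (M + 1) le_rfl
  -- The inputs may differ at time `0`, so no local Lipschitz estimate applies; bounded velocities
  -- suffice for `O(t)`.
  · refine isBigO_pow_succ_of_hasDerivAt hd (by simp [h0]) ?_
    have h1 : ContinuousAt (fun t => (f (a t) + g (a t) (u t)) - (f (b t) + g (b t) (v t))) 0 :=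
      (ContinuousAt.comp (f := fun t => (a t, u t)) hcont.continuousAt (hca.prodMk hu)).sub
        (ContinuousAt.comp (f := fun t => (b t, v t)) hcont.continuousAt (hcb.prodMk hv))
    simpa using h1.tendsto.isBigO_one ℝ

/-! ### Relative degree of the cascade -/

namespace SafetyData

variable {n m nc ℓ ℓu : ℕ} {S : SafetyData n m nc ℓ ℓu}

theorem Standing.fHat_locallyLipschitz (hS : S.Standing) : LocallyLipschitz S.fHat :=
  (hS.f_lip.comp_fst.add_fun (hS.g_lip.comp_fst.clm_apply hS.hc_lip.comp_snd)).prodMk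
    hS.fc_lip.comp_snd

/-- If two trajectories of `f̂` have constraint values that differ by `O(t ^ (d̂_j - 1))`, then
`b̂_{j,i}`, `i ≤ d̂_j - 2`, takes the same value at their initial points. -/
theorem bHat_eq_of_trajectories (hS : S.Standing) (hSm : S.Smooth) {j : Fin ℓ ⊕ Fin ℓu}
    {z w : ℝ → CascadeState n nc}
    (hz : ∀ᶠ t in 𝓝 (0 : ℝ), HasDerivAt z (S.fHat (z t)) t)
    (hw : ∀ᶠ t in 𝓝 (0 : ℝ), HasDerivAt w (S.fHat (w t)) t)
    (h0 : (fun t => S.hHatJ j (z t) - S.hHatJ j (w t)) =O[𝓝 0] fun t : ℝ => t ^ (S.dHat j - 1))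
    {i : ℕ} (hi : i + 2 ≤ S.dHat j) : S.bHat j i (z 0) = S.bHat j i (w 0) := by
  have hcz : ContinuousAt z 0 := hz.self_of_nhds.continuousAt
  have hcw : ContinuousAt w 0 := hw.self_of_nhds.continuousAt
  have hcb : ∀ k < S.dHat j, ContinuousAt (fun t => S.bHat j k (z t)) 0 ∧
      ContinuousAt (fun t => S.bHat j k (w t)) 0 := fun k hk =>
    ⟨(hSm.bHat_C1 j k hk).continuous.continuousAt.comp hcz,
      (hSm.bHat_C1 j k hk).continuous.continuousAt.comp hcw⟩
  -- The perturbation is the difference of the `α̂` terms. It is `O` of the difference of the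
  -- `b̂_{j,k}` once these agree at time `0`, since `α̂` is only locally Lipschitz.
  refine sub_eq_zero.1 (eq_zero_of_perturbed_derivatives (N := S.dHat j - 2)
    (fun k t => S.bHat j k (z t) - S.bHat j k (w t))
    (fun k t => lieD S.fHat (S.bHat j k) (z t) - lieD S.fHat (S.bHat j k) (w t))
    (fun k hk => (hcb k (by omega)).1.sub (hcb k (by omega)).2)
    (fun k hk => ?_) (fun k hk hk0 => ?_) ?_ i (by omega))
  · filter_upwards [hz, hw] with t h1 h2
    exact (hasDerivAt_comp_trajectory (hSm.bHat_C1 j k (by omega)) h1).sub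
      (hasDerivAt_comp_trajectory (hSm.bHat_C1 j k (by omega)) h2)
  · have h1 := (hS.αHat_lip j k (by omega)).isBigO_comp_sub (l := 𝓝 (0 : ℝ))
      (a := fun t => S.bHat j k (z t)) (b := fun t => S.bHat j k (w t)) (x := S.bHat j k (z 0))
      (hcb k (by omega)).1 (by rw [sub_eq_zero.1 hk0]; exact (hcb k (by omega)).2)
    refine h1.congr_left fun t => ?_
    simp only [bHat]
    ring
  · refine h0.trans_isLittleO ?_
    obtain ⟨q, hq⟩ := Nat.exists_eq_add_of_le hi
    rw [show S.dHat j - 1 = S.dHat j - 2 + 1 by omega]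
    have := (isBigO_refl (fun t : ℝ => t ^ (S.dHat j - 2)) (𝓝 0)).mul_isLittleO
      ((isLittleO_one_iff ℝ).2 (continuous_id.tendsto (0 : ℝ)))
    simpa [pow_succ] using this

theorem hasDerivAt_fst_of_fHat {z : ℝ → CascadeState n nc} {t : ℝ}
    (h : HasDerivAt z (S.fHat (z t)) t) :
    HasDerivAt (fun t => (z t).1) (S.f (z t).1 + S.g (z t).1 (S.hc (z t).2)) t :=
  (ContinuousLinearMap.fst ℝ (Euc n) (Euc nc)).hasFDerivAt.comp_hasDerivAt t h

theorem hasDerivAt_snd_of_fHat {z : ℝ → CascadeState n nc} {t : ℝ}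
    (h : HasDerivAt z (S.fHat (z t)) t) :
    HasDerivAt (fun t => (z t).2) (S.fc (z t).2) t :=
  (ContinuousLinearMap.snd ℝ (Euc n) (Euc nc)).hasFDerivAt.comp_hasDerivAt t h

/-- Trajectories of `f̂` from the same plant state and from controller states at which the
iterated Lie derivatives of `h_c` up to order `d_c - 2` agree. -/
theorem isBigO_plant_constraint_sub (hS : S.Standing) (hSm : S.Smooth) (hA1 : S.CondA1)
    (hC1 : S.CondC1) (j : Fin ℓ) {z w : ℝ → CascadeState n nc}
    (hz : ∀ᶠ t in 𝓝 (0 : ℝ), HasDerivAt z (S.fHat (z t)) t)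
    (hw : ∀ᶠ t in 𝓝 (0 : ℝ), HasDerivAt w (S.fHat (w t)) t)
    (hx : (z 0).1 = (w 0).1)
    (hxc : ∀ i, i + 2 ≤ S.dc →
      (lieD S.fc)^[i] S.hc (z 0).2 = (lieD S.fc)^[i] S.hc (w 0).2) :
    (fun t => S.h j (z t).1 - S.h j (w t).1) =O[𝓝 0] fun t : ℝ => t ^ (S.d j + S.dc - 1) := by
  have hdc := hC1.1
  have hdj := (hA1 j).1
  have hz1 := hz.mono fun t => hasDerivAt_fst_of_fHat
  have hw1 := hw.mono fun t => hasDerivAt_fst_of_fHat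
  have hz2 := hz.mono fun t => hasDerivAt_snd_of_fHat
  have hw2 := hw.mono fun t => hasDerivAt_snd_of_fHat
  have hu := isBigO_output_sub hSm.lie_hc hdc hz2 hw2 hxc
  have hhc : Continuous S.hc := hS.hc_lip.continuous
  have hX := isBigO_state_sub hS.f_lip hS.g_lip hz1 hw1 hx
    (hhc.continuousAt.comp hz2.self_of_nhds.continuousAt)
    (hhc.continuousAt.comp hw2.self_of_nhds.continuousAt)
    (by
      rcases Nat.lt_or_ge 1 S.dc with h | h
      · exact Or.inl (hxc 0 (by omega))
      · exact Or.inr (by omega)) hu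
  -- By A1 the input drops out of the derivatives of `h_j` below order `d_j`.
  have hd : ∀ (y : ℝ → CascadeState n nc) (t : ℝ) (i : ℕ), i < S.d j - 1 →
      HasDerivAt (fun t => (y t).1) (S.f (y t).1 + S.g (y t).1 (S.hc (y t).2)) t →
      HasDerivAt (fun t => (lieD S.f)^[i] (S.h j) (y t).1)
        ((lieD S.f)^[i + 1] (S.h j) (y t).1) t := by
    intro y t i hi hy
    refine (hasDerivAt_comp_trajectory (hSm.lie_h j i (by omega)) hy).congr_deriv ?_
    have h0 := DFunLike.congr_fun ((hA1 j).2.1 (y t).1 i (by omega)) (S.hc (y t).2)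
    simp only [lieDM, ContinuousLinearMap.comp_apply, zero_apply] at h0
    rw [map_add, h0, add_zero, Function.iterate_succ_apply', lieD]
  -- Order count: the outputs of the controller differ by `O(t ^ (d_c - 1))`, the plant states by
  -- one order more, and `d_j - 1` further integrations lead to `h_j`.
  have := isBigO_pow_of_successive_derivatives (M := S.dc - 1 + 1) (N := S.d j - 1)
    (fun i t => (lieD S.f)^[i] (S.h j) (z t).1 - (lieD S.f)^[i] (S.h j) (w t).1)
    (fun i hi => by
      filter_upwards [hz1, hw1] with t h1 h2 using (hd z t i hi h1).sub (hd w t i hi h2))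
    (fun i hi => by simp only [hx, sub_self])
    ((((hSm.lie_h j (S.d j - 1) (by omega)).locallyLipschitz).isBigO_comp_sub
      hz1.self_of_nhds.continuousAt (by
        simpa only [hx] using hw1.self_of_nhds.continuousAt.tendsto)).trans hX)
  rwa [show S.d j + S.dc - 1 = S.dc - 1 + 1 + (S.d j - 1) by omega]

/-- Moving the controller state along an integral curve of a column of `g_c` does not change
`b̂_{j,i}` for `i ≤ d̂_j - 2`. -/
theorem bHat_eq_along_controller_curve (hS : S.Standing) (hSm : S.Smooth) (hA1 : S.CondA1)
    (hC1 : S.CondC1) (hC2 : S.CondC2) (j : Fin ℓ ⊕ Fin ℓu) {i : ℕ} (hi : i + 2 ≤ S.dHat j)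
    (x : Euc n) (v : Euc m) {γ : ℝ → Euc nc} {ε : ℝ}
    (hγ : ∀ t ∈ Ioo (-ε) ε, HasDerivAt γ (S.gc (γ t) v) t) {s : ℝ} (hs : s ∈ Ioo (-ε) ε) :
    S.bHat j i (x, γ s) = S.bHat j i (x, γ 0) := by
  obtain ⟨z, hz0, ε₁, hε₁, hz⟩ := hS.fHat_locallyLipschitz.exists_hasDerivAt (x, γ s)
  obtain ⟨w, hw0, ε₂, hε₂, hw⟩ := hS.fHat_locallyLipschitz.exists_hasDerivAt (x, γ 0)
  have hz' : ∀ᶠ t in 𝓝 (0 : ℝ), HasDerivAt z (S.fHat (z t)) t :=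
    eventually_of_mem (Ioo_mem_nhds (by linarith) hε₁) hz
  have hw' : ∀ᶠ t in 𝓝 (0 : ℝ), HasDerivAt w (S.fHat (w t)) t :=
    eventually_of_mem (Ioo_mem_nhds (by linarith) hε₂) hw
  rw [← hz0, ← hw0]
  refine bHat_eq_of_trajectories hS hSm hz' hw' ?_ hi
  rcases j with j | κ
  · refine isBigO_plant_constraint_sub hS hSm hA1 hC1 j hz' hw' (by rw [hz0, hw0]) ?_
    intro k hk
    rw [hz0, hw0]
    -- By C1 the lower Lie derivatives of `h_c` are constant along the curve, so both drift
    -- trajectories start with the same output jet.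
    refine eq_of_fderiv_curve_eq_zero (hSm.lie_hc k (by omega)) hγ (fun t _ => ?_) hs
    exact DFunLike.congr_fun (hC1.2.1 (γ t) k hk) v
  · refine isBigO_output_sub (hSm.lie_φ κ) hC2.1 (hz'.mono fun t => hasDerivAt_snd_of_fHat)
      (hw'.mono fun t => hasDerivAt_snd_of_fHat) ?_
    intro k hk
    rw [hz0, hw0]
    refine eq_of_fderiv_curve_eq_zero (hSm.lie_φ κ k (by omega)) hγ (fun t _ => ?_) hs
    exact DFunLike.congr_fun (hC2.2.1 κ (γ t) k hk) v

/-- The functions `b̂_{j,i}` with `i ≤ d̂_j - 2` are not affected by the surrogate control. -/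
theorem lieDM_gHat_bHat_eq_zero (hS : S.Standing) (hSm : S.Smooth) (hA1 : S.CondA1)
    (hC1 : S.CondC1) (hC2 : S.CondC2) (j : Fin ℓ ⊕ Fin ℓu) {i : ℕ} (hi : i + 2 ≤ S.dHat j)
    (z : CascadeState n nc) : lieDM S.gHat (S.bHat j i) z = 0 := by
  ext v
  obtain ⟨γ, hγ0, ε, hε, hγ⟩ :=
    (hS.gc_lip.clm_apply (LocallyLipschitz.const v)).exists_hasDerivAt z.2
  have h0 : (0 : ℝ) ∈ Ioo (-ε) ε := ⟨by linarith, hε⟩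
  have hcurve : HasDerivAt (fun s => ((z.1, γ s) : CascadeState n nc))
      ((0 : Euc n), S.gc (γ 0) v) 0 := (hasDerivAt_const _ _).prodMk (hγ 0 h0)
  have h1 := hasDerivAt_comp_trajectory (hSm.bHat_C1 j i (by omega)) hcurve
  have h2 : HasDerivAt (fun s => S.bHat j i (z.1, γ s)) 0 0 := by
    refine (hasDerivAt_const (0 : ℝ) (S.bHat j i (z.1, γ 0))).congr_of_eventuallyEq ?_
    filter_upwards [Ioo_mem_nhds h0.1 h0.2] with s hs
    exact bHat_eq_along_controller_curve hS hSm hA1 hC1 hC2 j hi z.1 v hγ hs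
  have h3 := h1.unique h2
  rw [hγ0] at h3
  exact h3

end SafetyData

/-! ### Scalar comparison and the soft minimum -/

section Scalar

/-- The zero is the greatest element of the compact set where `y ≥ 0`; continuity from the right
gives `y c ≤ 0` there. -/
theorem exists_last_zero {y : ℝ → ℝ} {a b : ℝ} (hab : a ≤ b) (hc : ContinuousOn y (Icc a b))
    (ha : 0 ≤ y a) (hb : y b < 0) :
    ∃ c ∈ Ico a b, y c = 0 ∧ ∀ t ∈ Ioc c b, y t < 0 := by
  have hcl : IsCompact (Icc a b ∩ y ⁻¹' Ici 0) :=
    isCompact_Icc.of_isClosed_subset (hc.preimage_isClosed_of_isClosed isClosed_Icc isClosed_Ici)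
      inter_subset_left
  obtain ⟨c, ⟨hcI, hc0⟩, hcmax⟩ := hcl.exists_isGreatest ⟨a, left_mem_Icc.2 hab, ha⟩
  have hneg : ∀ t ∈ Ioc c b, y t < 0 := by
    intro t ht
    by_contra! h
    exact ht.1.not_ge (hcmax ⟨⟨hcI.1.trans ht.1.le, ht.2⟩, h⟩)
  have hcb : c < b := lt_of_le_of_ne hcI.2 (by rintro rfl; exact hb.not_ge hc0)
  refine ⟨c, ⟨hcI.1, hcb⟩, le_antisymm ?_ hc0, hneg⟩
  have ht : Tendsto y (𝓝[Ioc c b] c) (𝓝 (y c)) :=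
    (hc c hcI).mono_left (nhdsWithin_mono _ fun t ht => ⟨hcI.1.trans ht.1.le, ht.2⟩)
  have : (𝓝[Ioc c b] c).NeBot := by
    rw [nhdsWithin_Ioc_eq_nhdsGT hcb]; infer_instance
  exact le_of_tendsto ht (eventually_of_mem self_mem_nhdsWithin fun t h => (hneg t h).le)

/-- Grönwall by integrating factor: `y t * exp (-K t)` is nondecreasing. -/
theorem nonneg_of_mul_le_deriv {y y' : ℝ → ℝ} {c b K : ℝ} (hcb : c ≤ b)
    (hc : ContinuousOn y (Icc c b)) (hd : ∀ t ∈ Ioo c b, HasDerivAt y (y' t) t)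
    (hK : ∀ t ∈ Ioo c b, K * y t ≤ y' t) (h0 : 0 ≤ y c) : 0 ≤ y b := by
  have hE : ∀ t, HasDerivAt (fun t : ℝ => Real.exp (-K * t)) (Real.exp (-K * t) * (-K)) t :=
    fun t => by simpa using ((hasDerivAt_id t).const_mul (-K)).exp
  have hd' : ∀ t ∈ Ioo c b, HasDerivAt (fun t => y t * Real.exp (-K * t))
      (y' t * Real.exp (-K * t) + y t * (Real.exp (-K * t) * (-K))) t :=
    fun t ht => (hd t ht).mul (hE t)
  have hmono : MonotoneOn (fun t => y t * Real.exp (-K * t)) (Icc c b) := by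
    refine monotoneOn_of_deriv_nonneg (convex_Icc c b)
      (hc.mul (by fun_prop)) ?_ ?_
    · rw [interior_Icc]
      exact fun t ht => (hd' t ht).differentiableAt.differentiableWithinAt
    · rw [interior_Icc]
      intro t ht
      rw [(hd' t ht).deriv]
      have h1 := mul_nonneg (sub_nonneg.2 (hK t ht)) (Real.exp_pos (-K * t)).le
      linarith
  have h1 := hmono (left_mem_Icc.2 hcb) (right_mem_Icc.2 hcb) hcb
  have h2 : 0 ≤ y b * Real.exp (-K * b) :=
    (mul_nonneg h0 (Real.exp_pos _).le).trans h1
  exact nonneg_of_mul_nonneg_left h2 (Real.exp_pos _)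

theorem rowTranspose_self {m : ℕ} (L : Euc m →L[ℝ] ℝ) : L (rowTranspose L) = ‖L‖ ^ 2 := by
  rw [rowTranspose, ← InnerProductSpace.toDual_symm_apply, real_inner_self_eq_norm_sq,
    LinearIsometryEquiv.norm_map]

theorem softmin_le {ι : Type*} [Fintype ι] {ρ : ℝ} (hρ : 0 < ρ) (z : ι → ℝ) (i : ι) :
    softmin ρ z ≤ z i := by
  have h1 : Real.exp (-ρ * z i) ≤ ∑ i, Real.exp (-ρ * z i) :=
    Finset.single_le_sum (f := fun i => Real.exp (-ρ * z i))
      (fun _ _ => (Real.exp_pos _).le) (Finset.mem_univ i)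
  have h2 := Real.log_le_log (Real.exp_pos _) h1
  rw [Real.log_exp] at h2
  have h3 : z i = -(1 / ρ) * (-ρ * z i) := by field_simp
  rw [softmin, h3]
  exact mul_le_mul_of_nonpos_left h2 (neg_nonpos.2 (by positivity))

end Scalar

/-! ### The barrier inequality near the boundary -/

namespace SafetyData

variable {n m nc ℓ ℓu : ℕ} {S : SafetyData n m nc ℓ ℓu}

theorem dHat_pos (hA1 : S.CondA1) (hC2 : S.CondC2) (j : Fin ℓ ⊕ Fin ℓu) : 0 < S.dHat j := by
  rcases j with j | κ
  · exact Nat.add_pos_left (hA1 j).1 _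
  · exact hC2.1

theorem Smooth.hHat_contDiff (hSm : S.Smooth) (hd : ∀ j, 0 < S.dHat j) :
    ContDiff ℝ 1 S.hHat := by
  rcases isEmpty_or_nonempty (Fin ℓ ⊕ Fin ℓu) with hE | hN
  · have : S.hHat = fun _ => 0 := by
      funext z
      -- An empty sum gives `Real.log 0`, which is `0` by convention.
      simp [hHat, softmin]
    rw [this]
    exact contDiff_const
  · refine contDiff_const.mul (ContDiff.log (ContDiff.sum fun j _ => ?_) fun z => ?_)
    · exact (contDiff_const.mul (hSm.bHat_C1 j _ (Nat.sub_lt (hd j) one_pos))).exp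
    · exact (Finset.sum_pos (fun _ _ => Real.exp_pos _) Finset.univ_nonempty).ne'

theorem Standing.gHat_continuous (hS : S.Standing) : Continuous S.gHat := by
  have h : Continuous fun z : CascadeState n nc => S.gc z.2 :=
    hS.gc_lip.continuous.comp continuous_snd
  have h2 : S.gHat = fun z => (ContinuousLinearMap.inr ℝ (Euc n) (Euc nc)).comp (S.gc z.2) := by
    funext z
    ext v <;> simp [gHat]
  rw [h2]
  exact continuous_const.clm_comp h

theorem continuous_uHatD (hS : S.Standing) (hSm : S.Smooth) (hC1 : S.CondC1) :
    Continuous S.uHatD := by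
  obtain ⟨k, hk⟩ : ∃ k, S.dc = k + 1 := ⟨S.dc - 1, by have := hC1.1; omega⟩
  have hf : Continuous S.fHat := hS.fHat_locallyLipschitz.continuous
  -- The iterate of order `d_c` is not assumed C¹; it is continuous as the derivative of the
  -- previous one applied to `f̂`.
  have huD : ∀ i ≤ S.dc, Continuous ((lieD S.fHat)^[i] S.uD) := by
    intro i hi
    rcases Nat.lt_or_ge i S.dc with h | h
    · exact (hSm.lie_uD i h).continuous
    · obtain rfl : i = k + 1 := by omega
      rw [Function.iterate_succ_apply']
      exact ((hSm.lie_uD k (by omega)).continuous_fderiv one_ne_zero).clm_apply hf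
  have hhc : ∀ i ≤ S.dc, Continuous ((lieD S.fc)^[i] S.hc) := by
    intro i hi
    rcases Nat.lt_or_ge i S.dc with h | h
    · exact (hSm.lie_hc i h).continuous
    · obtain rfl : i = k + 1 := by omega
      rw [Function.iterate_succ_apply']
      exact ((hSm.lie_hc k (by omega)).continuous_fderiv one_ne_zero).clm_apply
        hS.fc_lip.continuous
  have hM : Continuous fun xc => lieDM S.gc ((lieD S.fc)^[S.dc - 1] S.hc) xc :=
    ((hSm.lie_hc (S.dc - 1) (by omega)).continuous_fderiv one_ne_zero).clm_comp
      hS.gc_lip.continuous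
  have hinv : Continuous fun xc => (lieDM S.gc ((lieD S.fc)^[S.dc - 1] S.hc) xc).inverse := by
    rw [continuous_iff_continuousAt]
    intro xc
    obtain ⟨U, hU⟩ := hC1.2.2 xc
    have h1 := (contDiffAt_map_inverse (𝕜 := ℝ) (n := 0)
      (ContinuousLinearEquiv.unitsEquiv ℝ (Euc m) U)).continuousAt
    rw [show ((ContinuousLinearEquiv.unitsEquiv ℝ (Euc m) U : Euc m ≃L[ℝ] Euc m) :
      Euc m →L[ℝ] Euc m) = lieDM S.gc ((lieD S.fc)^[S.dc - 1] S.hc) xc from hU] at h1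
    exact ContinuousAt.comp (f := fun xc => lieDM S.gc ((lieD S.fc)^[S.dc - 1] S.hc) xc)
      h1 hM.continuousAt
  refine (hinv.comp continuous_snd).clm_apply
    (((huD _ le_rfl).sub ((hhc _ le_rfl).comp continuous_snd)).add
      (continuous_finsetSum _ fun i hi => Continuous.const_smul ?_ (S.σ i)))
  have hi' := (Finset.mem_range.1 hi).le
  exact (huD i hi').sub ((hhc i hi').comp continuous_snd)

/-- The derivative of `ĥ` along the closed loop. -/
theorem fderiv_hHat_closedLoop (z : CascadeState n nc) :
    fderiv ℝ S.hHat z (S.closedLoop z) =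
      S.ωHat z - S.α (S.hHat z) + S.lamHat z * ‖lieDM S.gHat S.hHat z‖ ^ 2 := by
  have h : ∀ v, fderiv ℝ S.hHat z (S.gHat z v) = lieDM S.gHat S.hHat z v := fun v => rfl
  rw [closedLoop, map_add, h, uHat, map_add, map_smul, rowTranspose_self, ωHat, lieD, smul_eq_mul]
  ring

/-- Near a boundary point of `Ĥ`, the derivative of `ĥ` along the closed loop is bounded below by
a multiple of `ĥ` wherever `ĥ < 0`. -/
theorem exists_mul_le_fderiv_hHat (hS : S.Standing) (hSm : S.Smooth) (hC1 : S.CondC1)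
    (hd : ∀ j, 0 < S.dHat j) (hB : ∀ z ∈ S.BHat, lieDM S.gHat S.hHat z ≠ 0)
    {z : CascadeState n nc} (hz : z ∈ frontier S.HHat) (hz0 : S.hHat z = 0) :
    ∃ K : ℝ, ∀ᶠ w in 𝓝 z, S.hHat w < 0 →
      K * S.hHat w ≤ fderiv ℝ S.hHat w (S.closedLoop w) := by
  have hh := hSm.hHat_contDiff hd
  have hfd := hh.continuous_fderiv one_ne_zero
  have hLf : Continuous (lieD S.fHat S.hHat) :=
    hfd.clm_apply hS.fHat_locallyLipschitz.continuous
  have hLg : Continuous (lieDM S.gHat S.hHat) := hfd.clm_comp hS.gHat_continuous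
  have hω : Continuous S.ωHat :=
    (hLf.add (hLg.clm_apply (continuous_uHatD hS hSm hC1))).add
      (hS.α_lip.continuous.comp hh.continuous)
  have hα : ∀ w, S.hHat w < 0 → S.α (S.hHat w) ≤ 0 := fun w hw =>
    (hS.α_mono hw.le).trans_eq hS.α_zero
  have hlam : ∀ w, w ∉ S.ΩHat → S.lamHat w = 0 := fun w hw => if_neg hw
  have hnon : ∀ {K : ℝ}, 0 ≤ K → ∀ w, S.hHat w < 0 → w ∉ S.ΩHat →
      K * S.hHat w ≤ fderiv ℝ S.hHat w (S.closedLoop w) := by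
    intro K hK w hw hwΩ
    rw [fderiv_hHat_closedLoop, hlam w hwΩ]
    have h1 : 0 ≤ S.ωHat w := not_lt.1 hwΩ
    have h2 := mul_nonpos_of_nonneg_of_nonpos hK hw.le
    linarith [hα w hw]
  by_cases hL : lieDM S.gHat S.hHat z = 0
  · have h1 : 0 < S.ωHat z := by
      have h2 : 0 < lieD S.fHat S.hHat z := by
        by_contra! h
        exact hB z ⟨hz, h⟩ hL
      simpa [ωHat, hL, hz0, hS.α_zero] using h2
    refine ⟨0, ?_⟩
    filter_upwards [continuousAt_const.eventually_lt hω.continuousAt h1] with w hw hwn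
    exact hnon le_rfl w hwn (not_lt.2 hw.le)
  · have hp : 0 < ‖lieDM S.gHat S.hHat z‖ ^ 2 := by
      have := norm_pos_iff.2 hL
      positivity
    -- Half the value at `z` and one more than `|ω̂ z|` are bounds that persist on a neighbourhood
    -- of `z`.
    set p := ‖lieDM S.gHat S.hHat z‖ ^ 2 / 2 with hpdef
    have hp0 : 0 < p := half_pos hp
    set W := |S.ωHat z| + 1 with hW
    have hW0 : 0 < W := by positivity
    have hγ := hS.γ_pos
    have hK : 0 ≤ W * S.γ⁻¹ / p := by positivity
    refine ⟨W * S.γ⁻¹ / p, ?_⟩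
    filter_upwards [continuousAt_const.eventually_lt (hLg.norm.pow 2).continuousAt (half_lt_self hp),
      continuousAt_const.eventually_lt hω.continuousAt
        (show -W < S.ωHat z by linarith [neg_abs_le (S.ωHat z)]),
      continuousAt_const.eventually_lt hh.continuous.continuousAt
        (show (-1 : ℝ) < S.hHat z by rw [hz0]; norm_num)] with w hw1 hw2 hw3 hwn
    by_cases hwΩ : w ∈ S.ΩHat
    swap
    · exact hnon hK w hwn hwΩ
    rw [fderiv_hHat_closedLoop, lamHat, if_pos hwΩ, rowTranspose_self]
    set N := ‖lieDM S.gHat S.hHat w‖ ^ 2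
    set y := S.hHat w
    have hωn : S.ωHat w < 0 := hwΩ
    set o := S.ωHat w
    have hpN : p < N := hw1
    have hq : 0 ≤ S.γ⁻¹ * y ^ 2 := by positivity
    have hN : 0 < N + S.γ⁻¹ * y ^ 2 := by linarith
    -- The multiplier would cancel `ω̂` exactly without the slack `γ⁻¹ ĥ²`; only this slack's share
    -- of `ω̂` remains.
    have e1 : o - S.α y + -(o / (N + S.γ⁻¹ * y ^ 2)) * N =
        -S.α y - (-o) * (S.γ⁻¹ * y ^ 2) / (N + S.γ⁻¹ * y ^ 2) := by
      generalize S.γ⁻¹ * y ^ 2 = q at hN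
      field_simp
      ring
    have e2 : (-o) * (S.γ⁻¹ * y ^ 2) / (N + S.γ⁻¹ * y ^ 2) ≤ W * (S.γ⁻¹ * (-y)) / p := by
      -- With `-1 < ĥ < 0`, the quadratic slack is traded for a linear one, which the comparison can
      -- absorb.
      have hy : y ^ 2 ≤ -y := by nlinarith
      have hg : 0 ≤ S.γ⁻¹ := by positivity
      have hy0 : 0 ≤ -y := by linarith
      exact div_le_div₀ (by positivity)
        (mul_le_mul (by linarith) (mul_le_mul_of_nonneg_left hy hg) hq hW0.le) hp0 (by linarith)
    have e3 : W * (S.γ⁻¹ * (-y)) / p = -(W * S.γ⁻¹ / p * y) := by ring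
    rw [e1]
    linarith [hα w hwn]

/-! ### Invariance along solutions -/

section Trajectory

variable {F : CascadeState n nc → CascadeState n nc} {z₀ : CascadeState n nc} {tmax : EReal}
  {z : ℝ → CascadeState n nc}

theorem Icc_subset_timeInterval {t : ℝ} (ht : t ∈ timeInterval tmax) :
    Icc 0 t ⊆ timeInterval tmax := fun _ hs =>
  ⟨hs.1, (EReal.coe_le_coe_iff.2 hs.2).trans_lt ht.2⟩

theorem IsSolution.continuousOn_Icc (hz : IsSolution F z₀ tmax z) {t : ℝ}
    (ht : t ∈ timeInterval tmax) : ContinuousOn z (Icc 0 t) := fun s hs =>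
  ((hz.2 s (Icc_subset_timeInterval ht hs)).continuousWithinAt).mono (Icc_subset_timeInterval ht)

theorem IsSolution.hasDerivAt (hz : IsSolution F z₀ tmax z) {t s : ℝ}
    (ht : t ∈ timeInterval tmax) (hs : s ∈ Ioo 0 t) : HasDerivAt z (F (z s)) s :=
  (hz.2 s (Icc_subset_timeInterval ht (Ioo_subset_Icc_self hs))).hasDerivAt
    (mem_of_superset (Icc_mem_nhds hs.1 hs.2) (Icc_subset_timeInterval ht))

/-- A continuously differentiable function that is initially nonnegative remains so along a
solution if, near each of its zeros in the closure of the set where it is negative, its derivative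
is bounded below by a multiple of it wherever it is negative on the solution. -/
theorem nonneg_along_solution (hz : IsSolution F z₀ tmax z) {η : CascadeState n nc → ℝ}
    (hη : ContDiff ℝ 1 η) (h0 : 0 ≤ η z₀)
    (hK : ∀ s ∈ timeInterval tmax, η (z s) = 0 → z s ∈ closure {w | η w < 0} →
      ∃ K : ℝ, ∀ᶠ r in 𝓝[>] s, r ∈ timeInterval tmax → η (z r) < 0 →
        K * η (z r) ≤ fderiv ℝ η (z r) (F (z r)))
    {t : ℝ} (ht : t ∈ timeInterval tmax) : 0 ≤ η (z t) := by
  by_contra! hneg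
  have hzc := IsSolution.continuousOn_Icc hz ht
  have hyc : ContinuousOn (fun s => η (z s)) (Icc 0 t) := hη.continuous.comp_continuousOn hzc
  obtain ⟨c, hc, hc0, hcneg⟩ := exists_last_zero ht.1 hyc (by rwa [hz.1]) hneg
  have hcI : c ∈ Icc 0 t := Ico_subset_Icc_self hc
  have hmem : z c ∈ closure {w | η w < 0} := by
    have hT : Tendsto z (𝓝[Ioc c t] c) (𝓝 (z c)) :=
      (hzc c hcI).mono_left (nhdsWithin_mono _ fun s hs => ⟨hc.1.trans hs.1.le, hs.2⟩)
    have : (𝓝[Ioc c t] c).NeBot := by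
      rw [nhdsWithin_Ioc_eq_nhdsGT hc.2]; infer_instance
    exact mem_closure_of_tendsto hT (eventually_of_mem self_mem_nhdsWithin hcneg)
  obtain ⟨K, hKev⟩ := hK c (Icc_subset_timeInterval ht hcI) hc0 hmem
  obtain ⟨b, hb, hsub⟩ := (mem_nhdsGT_iff_exists_mem_Ioc_Ioo_subset hc.2).1 hKev
  have hb0 : 0 ≤ η (z b) := by
    refine nonneg_of_mul_le_deriv (K := K) (y := fun s => η (z s)) hb.1.le
      (hyc.mono (Icc_subset_Icc hc.1 hb.2))
      (fun s hs => hasDerivAt_comp_trajectory hη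
        (IsSolution.hasDerivAt hz ht ⟨hc.1.trans_lt hs.1, hs.2.trans_le hb.2⟩))
      (fun s hs => hsub hs ?_ ?_) hc0.ge
    · exact Icc_subset_timeInterval ht ⟨hc.1.trans hs.1.le, hs.2.le.trans hb.2⟩
    · exact hcneg s ⟨hs.1, hs.2.le.trans hb.2⟩
  exact (hcneg b hb).not_ge hb0

theorem hHat_nonneg_along_solution (hS : S.Standing) (hSm : S.Smooth) (hC1 : S.CondC1)
    (hd : ∀ j, 0 < S.dHat j) (hB : ∀ z ∈ S.BHat, lieDM S.gHat S.hHat z ≠ 0)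
    (hz₀ : 0 ≤ S.hHat z₀) (hz : IsSolution S.closedLoop z₀ tmax z) {t : ℝ}
    (ht : t ∈ timeInterval tmax) : 0 ≤ S.hHat (z t) := by
  have hh := hSm.hHat_contDiff hd
  refine nonneg_along_solution hz hh hz₀ (fun s hs hs0 hcl => ?_) ht
  -- A zero of `hHat` may be interior to `HHat`; being a limit of points with `ĥ < 0` puts it on the
  -- frontier, where the condition on `BHat` applies.
  have hfr : z s ∈ frontier S.HHat := by
    rw [frontier_eq_closure_inter_closure]
    refine ⟨subset_closure hs0.ge, ?_⟩
    have : S.HHatᶜ = {w | S.hHat w < 0} := by ext w; simp [HHat]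
    rwa [this]
  obtain ⟨K, hK⟩ := exists_mul_le_fderiv_hHat hS hSm hC1 hd hB hfr hs0
  refine ⟨K, ?_⟩
  have hT : Tendsto z (𝓝[timeInterval tmax] s) (𝓝 (z s)) := (hz.2 s hs).continuousWithinAt
  have h1 := eventually_nhdsWithin_iff.1 (hT.eventually hK)
  exact nhdsWithin_le_nhds h1

theorem nonneg_bHat_of_mem_CHatJ {j : Fin ℓ ⊕ Fin ℓu} {w : CascadeState n nc}
    (hw : w ∈ S.CHatJ j) {i : ℕ} (hi : i + 2 ≤ S.dHat j) : 0 ≤ S.bHat j i w := by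
  rw [CHatJ, if_neg (by omega)] at hw
  exact mem_iInter₂.1 hw i (Finset.mem_range.2 (by omega))

theorem mem_CHatJ_of_nonneg_bHat {j : Fin ℓ ⊕ Fin ℓu} {w : CascadeState n nc}
    (hw : ∀ i < S.dHat j, 0 ≤ S.bHat j i w) : w ∈ S.CHatJ j := by
  rw [CHatJ]
  split_ifs with h
  · exact hw 0 (by omega)
  · exact mem_iInter₂.2 fun i hi => hw i (by have := Finset.mem_range.1 hi; omega)

/-- Induction on `r = d̂_j - 1 - i`, that is, downwards in `i` from the top function, which
dominates `hHat`. -/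
theorem bHat_nonneg_along_solution (hS : S.Standing) (hSm : S.Smooth) (hA1 : S.CondA1)
    (hC1 : S.CondC1) (hC2 : S.CondC2) (hB : ∀ z ∈ S.BHat, lieDM S.gHat S.hHat z ≠ 0)
    (hz₀ : z₀ ∈ S.SHat) (hz : IsSolution S.closedLoop z₀ tmax z) (j : Fin ℓ ⊕ Fin ℓu) :
    ∀ r i, i + r + 1 = S.dHat j → ∀ t ∈ timeInterval tmax, 0 ≤ S.bHat j i (z t) := by
  intro r
  induction r with
  | zero =>
    intro i hi t ht
    have h1 := hHat_nonneg_along_solution hS hSm hC1 (dHat_pos hA1 hC2) hB hz₀.1 hz ht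
    obtain rfl : i = S.dHat j - 1 := by omega
    exact h1.trans (softmin_le hS.ρ_pos _ j)
  | succ r ih =>
    intro i hi t ht
    have hnext := ih (i + 1) (by omega)
    -- `K = 0` suffices: where `b̂_{j,i} < 0`, its derivative `b̂_{j,i+1} - α̂(b̂_{j,i})` is a
    -- nonnegative number minus a negative one.
    refine nonneg_along_solution hz (hSm.bHat_C1 j i (by omega))
      (nonneg_bHat_of_mem_CHatJ (mem_iInter.1 hz₀.2 j) (by omega)) (fun s _ _ _ => ⟨0, ?_⟩) ht
    refine Eventually.of_forall fun q hq hneg => ?_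
    have h1 := hnext q hq
    have h2 : fderiv ℝ (S.bHat j i) (z q) (S.gHat (z q) (S.uHat (z q))) = 0 :=
      DFunLike.congr_fun
        (lieDM_gHat_bHat_eq_zero hS hSm hA1 hC1 hC2 j (i := i) (by omega) (z q)) (S.uHat (z q))
    have hK := hS.αHat_classK j i (by omega)
    have h3 : S.αHat j i (S.bHat j i (z q)) < 0 := (hK.2.1 hneg).trans_eq hK.2.2
    rw [closedLoop, map_add, h2]
    simp only [bHat, lieD] at h1
    linarith

end Trajectory

end SafetyData

theorem mainTheorem1 {n m nc ℓ ℓu : ℕ} (S : SafetyData n m nc ℓ ℓu)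
    (hStanding : S.Standing) (hSmooth : S.Smooth)
    (hA1 : S.CondA1) (hC1 : S.CondC1) (hC2 : S.CondC2)
    (hLip : LocallyLipschitzOn S.SHat (fderiv ℝ S.hHat))
    (hB : ∀ z ∈ S.BHat, lieDM S.gHat S.hHat z ≠ 0)
    (z₀ : CascadeState n nc) (hz₀ : z₀ ∈ S.SHat)
    (tmax : EReal) (z : ℝ → CascadeState n nc)
    (hz : IsSolution S.closedLoop z₀ tmax z) :
    ∀ t ∈ timeInterval tmax,
      z t ∈ S.SHat ∧ (z t).1 ∈ S.safeSet ∧ S.hc (z t).2 ∈ S.inputSet := by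
  intro t ht
  have hd := SafetyData.dHat_pos hA1 hC2
  have hb : ∀ j, ∀ i < S.dHat j, 0 ≤ S.bHat j i (z t) := fun j i hi =>
    SafetyData.bHat_nonneg_along_solution hStanding hSmooth hA1 hC1 hC2 hB hz₀ hz j
      (S.dHat j - 1 - i) i (by omega) t ht
  refine ⟨⟨?_, ?_⟩, fun j => hb (Sum.inl j) 0 (hd _), fun κ => hb (Sum.inr κ) 0 (hd _)⟩
  · exact SafetyData.hHat_nonneg_along_solution hStanding hSmooth hC1 hd hB hz₀.1 hz ht
  · exact mem_iInter.2 fun j => SafetyData.mem_CHatJ_of_nonneg_bHat (hb j)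

end
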